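/- Let $X$ and $Y$ be Banach spaces over the same field $\mathbb{K}\in\{\mathbb{R},\mathbb{C}\}$, and let $\mathcal{L}(X,Y)$ denote the set of bounded linear operators from $X$ to $Y$. An operator $T\in\mathcal{L}(X,Y)$ is upper semi-Fredholm if its kernel is finite-dimensional and its range is closed; it is strictly singular if there is no closed infinite-dimensional subspace $M$ of $X$ such that the restriction $T|_M$ is an isomorphism onto its image. Let $\Phi_+(X,Y)$ and $\mathcal{SS}(X,Y)$ be the sets of upper semi-Fredholm and of strictly singular operators from $X$ to $Y$, and let $$P\Phi_+(X,Y)=\{K\in\mathcal{L}(X,Y) : T+K\in\Phi_+(X,Y)\text{ for every }T\in\Phi_+(X,Y)\}.$$ The space $X$ is subprojective if every closed infinite-dimensional subspace of $X$ contains an infinite-dimensional subspace that is complemented in $X$ (i.e. is the range of a bounded linear projection on $X$). Suppose that $\Phi_+(X,Y)$ is not empty and that $X$ is subprojective. Then $P\Phi_+(X,Y)=\mathcal{SS}(X,Y)$. -/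

import Mathlib

section Operators

variable {𝕜 : Type*} [RCLike 𝕜]
  {X : Type*} [NormedAddCommGroup X] [NormedSpace 𝕜 X]
  {Y : Type*} [NormedAddCommGroup Y] [NormedSpace 𝕜 Y]

/-- An operator is upper semi-Fredholm if its kernel is finite-dimensional and its range is
closed. -/
def IsUpperSemiFredholm (T : X →L[𝕜] Y) : Prop :=
  FiniteDimensional 𝕜 T.ker ∧ IsClosed (T.range : Set Y)

/-- An operator is strictly singular if its restriction to a closed infinite-dimensional subspace
is never an isomorphism (onto its image). -/
def IsStrictlySingular (T : X →L[𝕜] Y) : Prop :=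
  ∀ M : Submodule 𝕜 X, IsClosed (M : Set X) → ¬ FiniteDimensional 𝕜 M →
    ¬ Topology.IsEmbedding (T ∘L M.subtypeL)

/-- The perturbation class of a set `A` of operators from `X` to `Y`. -/
def perturbationClass (A : Set (X →L[𝕜] Y)) : Set (X →L[𝕜] Y) :=
  {K | ∀ T ∈ A, T + K ∈ A}

variable (𝕜 X Y)

/-- The set `Φ₊(X, Y)` of upper semi-Fredholm operators from `X` to `Y`. -/
def upperSemiFredholm : Set (X →L[𝕜] Y) :=
  {T | IsUpperSemiFredholm T}

/-- The set `SS(X, Y)` of strictly singular operators from `X` to `Y`. -/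
def strictlySingular : Set (X →L[𝕜] Y) :=
  {T | IsStrictlySingular T}

/-- A space is subprojective if every closed infinite-dimensional subspace contains an
infinite-dimensional subspace that is complemented in the whole space (that is, it is the range of
a continuous projection; in particular it is closed). -/
def IsSubprojective : Prop :=
  ∀ M : Submodule 𝕜 X, IsClosed (M : Set X) → ¬ FiniteDimensional 𝕜 M →
    ∃ N : Submodule 𝕜 X, N ≤ M ∧ ¬ FiniteDimensional 𝕜 N ∧ N.ClosedComplemented

end Operators

open Filter Topology

section

variable {𝕜 : Type*} [RCLike 𝕜]
  {X : Type*} [NormedAddCommGroup X] [NormedSpace 𝕜 X]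
  {Y : Type*} [NormedAddCommGroup Y] [NormedSpace 𝕜 Y]

/-! An upper semi-Fredholm operator is bounded below on a subspace of finite codimension; any other
operator agrees with a compact one on an infinite-dimensional subspace
(`exists_isCompactOperator_of_not_isUpperSemiFredholm`). Hence every operator is compact or bounded
below on some closed infinite-dimensional subspace of a given one.

If `T` is in Φ₊, `K` is strictly singular and `T + K` is not in Φ₊, then `T + K = C` on an
infinite-dimensional space with `C` compact. As `K` is compact on a smaller one, so is `T`, which is
absurd.

Conversely, let `K` in PΦ₊ be bounded below on `M`. PΦ₊ is stable under composition on the right, so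
for a projection `P` onto an infinite-dimensional subspace of `M` the operator `K P` lies in PΦ₊.
With `S` in Φ₊, the sum `K P + S (1 - P)` is not in Φ₊, hence agrees with a compact operator on an
infinite-dimensional space. If `1 - P` is compact on a subspace of it, then `K P` is both compact
and bounded below on a smaller one. Otherwise a second use of subprojectivity yields a projection
`q` of infinite rank with `S q` in PΦ₊, although `S - S q` vanishes on the range of `q`. -/

/-! ### Compactness and lower bounds on subspaces -/

theorem isCompactOperator_comp_subtypeL_iff {T : X →L[𝕜] Y} {M : Submodule 𝕜 X} :
    IsCompactOperator (T ∘L M.subtypeL) ↔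
      ∃ K : Set Y, IsCompact K ∧ ∀ x ∈ M, ‖x‖ ≤ 1 → T x ∈ K := by
  have h := isCompactOperator_iff_image_closedBall_subset_compact
    (T ∘L M.subtypeL : M →ₗ[𝕜] Y) one_pos
  refine Iff.trans h ⟨?_, ?_⟩
  · rintro ⟨K, hK, hs⟩
    exact ⟨K, hK, fun x hx h1 => hs ⟨⟨x, hx⟩, by simpa using h1, rfl⟩⟩
  · rintro ⟨K, hK, hs⟩
    refine ⟨K, hK, ?_⟩
    rintro _ ⟨⟨x, hx⟩, h1, rfl⟩
    exact hs x hx (by simpa using h1)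

theorem IsCompactOperator.comp_subtypeL_mono {T : X →L[𝕜] Y} {M N : Submodule 𝕜 X}
    (h : IsCompactOperator (T ∘L M.subtypeL)) (hN : N ≤ M) :
    IsCompactOperator (T ∘L N.subtypeL) := by
  rw [isCompactOperator_comp_subtypeL_iff] at h ⊢
  obtain ⟨K, hK, hs⟩ := h
  exact ⟨K, hK, fun x hx => hs x (hN hx)⟩

theorem isClosedEmbedding_comp_subtypeL [CompleteSpace X] {T : X →L[𝕜] Y} {M : Submodule 𝕜 X}
    (hM : IsClosed (M : Set X)) {c : ℝ} (hc : ∀ x ∈ M, ‖x‖ ≤ c * ‖T x‖) :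
    IsClosedEmbedding (T ∘L M.subtypeL) := by
  have : CompleteSpace M := hM.completeSpace_coe
  have hanti : AntilipschitzWith c.toNNReal (T ∘L M.subtypeL) := by
    refine ContinuousLinearMap.antilipschitz_of_bound _ fun x => (hc x x.2).trans ?_
    exact mul_le_mul_of_nonneg_right (Real.le_coe_toNNReal c) (norm_nonneg _)
  exact hanti.isClosedEmbedding (T ∘L M.subtypeL).uniformContinuous

theorem exists_bound_of_isEmbedding {T : X →L[𝕜] Y} {M : Submodule 𝕜 X}
    (h : IsEmbedding (T ∘L M.subtypeL)) : ∃ c : ℝ, 0 ≤ c ∧ ∀ x ∈ M, ‖x‖ ≤ c * ‖T x‖ := by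
  obtain ⟨c, hc⟩ := ContinuousLinearMap.antilipschitz_of_isEmbedding _ h
  exact ⟨c, c.2, fun x hx => by simpa using hc.le_mul_norm_sub ⟨x, hx⟩ 0⟩

/-- An operator which is both compact and bounded below on a closed subspace forces this subspace
to be finite-dimensional. -/
theorem finiteDimensional_of_isCompactOperator_of_bound [CompleteSpace X] {T : X →L[𝕜] Y}
    {M : Submodule 𝕜 X} (hM : IsClosed (M : Set X)) (hT : IsCompactOperator (T ∘L M.subtypeL))
    {c : ℝ} (hc : ∀ x ∈ M, ‖x‖ ≤ c * ‖T x‖) : FiniteDimensional 𝕜 M := by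
  obtain ⟨K, hK, hs⟩ := hT
  exact FiniteDimensional.of_isCompactOperator_id
    ⟨_, (isClosedEmbedding_comp_subtypeL hM hc).isCompact_preimage hK, hs⟩

/-! ### Upper semi-Fredholm operators and lower bounds in finite codimension -/

theorem not_finiteDimensional_inf_ker {M : Submodule 𝕜 X} (hM : ¬ FiniteDimensional 𝕜 M)
    (P : X →L[𝕜] X) [FiniteDimensional 𝕜 P.range] :
    ¬ FiniteDimensional 𝕜 (M ⊓ P.ker : Submodule 𝕜 X) := by
  intro h
  apply hM
  have hfg : (M.map P.toLinearMap).FG := by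
    have : FiniteDimensional 𝕜 (M.map P.toLinearMap) :=
      Submodule.finiteDimensional_of_le (LinearMap.map_le_range (f := P.toLinearMap))
    exact Module.Finite.iff_fg.1 this
  exact Module.Finite.iff_fg.2
    (Submodule.fg_of_fg_map_of_fg_inf_ker P.toLinearMap hfg (Module.Finite.iff_fg.1 h))

/-- An operator that is bounded below on a closed subspace of finite codimension is upper
semi-Fredholm. -/
theorem IsUpperSemiFredholm.of_bound [CompleteSpace X] {T : X →L[𝕜] Y} (P : X →L[𝕜] X)
    [FiniteDimensional 𝕜 P.range] {c : ℝ} (hc : ∀ x, P x = 0 → ‖x‖ ≤ c * ‖T x‖) :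
    IsUpperSemiFredholm T := by
  constructor
  · by_contra h
    refine not_finiteDimensional_inf_ker h P ?_
    have : T.ker ⊓ P.ker = ⊥ := by
      rw [eq_bot_iff]
      rintro x ⟨hx, hPx⟩
      have hTx : T x = 0 := hx
      have := hc x hPx
      rw [hTx] at this
      simpa using this
    rw [this]
    infer_instance
  · have hcl := (isClosedEmbedding_comp_subtypeL (T := T) (M := P.ker)
      P.isClosed_ker (c := c) fun x hx => hc x hx).isClosed_range
    have : (P.ker).CoFG := by
      have : FiniteDimensional 𝕜 (X ⧸ P.ker) :=
        LinearEquiv.finiteDimensional (P.toLinearMap.quotKerEquivRange).symm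
      exact this
    refine LinearMap.isClosed_range_of_isClosed_map_of_finiteDimensional_quotient
      (f := T.toLinearMap) (s := P.ker) ?_
    convert hcl using 1
    ext y
    simp

/-- Converse of `IsUpperSemiFredholm.of_bound`: `P` projects onto the kernel of `T`, and the open
mapping theorem applies to `T` on the complement. -/
theorem IsUpperSemiFredholm.exists_bound [CompleteSpace X] [CompleteSpace Y] {T : X →L[𝕜] Y}
    (hT : IsUpperSemiFredholm T) :
    ∃ P : X →L[𝕜] X, FiniteDimensional 𝕜 P.range ∧
      ∃ c : ℝ, ∀ x, P x = 0 → ‖x‖ ≤ c * ‖T x‖ := by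
  obtain ⟨hker, hran⟩ := hT
  obtain ⟨p, hp⟩ := Submodule.ClosedComplemented.of_finiteDimensional T.ker
  have hPk : ∀ x, (T.ker.subtypeL ∘L p) x = 0 → p x = 0 := fun x hx => Subtype.ext hx
  refine ⟨T.ker.subtypeL ∘L p, ?_, ?_⟩
  · refine Submodule.finiteDimensional_of_le (S₂ := T.ker) ?_
    rintro _ ⟨x, rfl⟩
    exact (p x).2
  · have : CompleteSpace p.ker := p.isClosed_ker.completeSpace_coe
    have hinj : Function.Injective (T ∘L p.ker.subtypeL) := by
      rw [injective_iff_map_eq_zero]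
      rintro ⟨x, hx⟩ hTx
      have h1 := hp ⟨x, hTx⟩
      have h2 : p x = 0 := hx
      rw [h2] at h1
      exact Subtype.ext (congrArg Subtype.val h1).symm
    have hclosed : IsClosed (Set.range (T ∘L p.ker.subtypeL)) := by
      convert hran using 1
      ext y
      constructor
      · rintro ⟨x, rfl⟩
        exact ⟨x, rfl⟩
      · rintro ⟨x, rfl⟩
        refine ⟨⟨x - p x, ?_⟩, ?_⟩
        · change p (x - p x) = 0
          rw [map_sub, hp, sub_self]
        · have : T (p x) = 0 := (p x).2
          simp [this]
    obtain ⟨c, hc⟩ := (T ∘L p.ker.subtypeL).antilipschitz_of_injective_of_isClosed_range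
      hinj hclosed
    exact ⟨c, fun x hx => by simpa using hc.le_mul_norm_sub ⟨x, hPk x hx⟩ 0⟩

theorem IsUpperSemiFredholm.not_isCompactOperator_comp_subtypeL [CompleteSpace X]
    [CompleteSpace Y] {T : X →L[𝕜] Y} (hT : IsUpperSemiFredholm T) {M : Submodule 𝕜 X}
    (hM : IsClosed (M : Set X)) (hinf : ¬ FiniteDimensional 𝕜 M) :
    ¬ IsCompactOperator (T ∘L M.subtypeL) := by
  intro h
  obtain ⟨P, hP, c, hc⟩ := hT.exists_bound
  exact not_finiteDimensional_inf_ker hinf P <|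
    finiteDimensional_of_isCompactOperator_of_bound (hM.inter P.isClosed_ker)
      (h.comp_subtypeL_mono inf_le_left) (c := c) fun x hx => hc x hx.2

/-! ### Compact behaviour on infinite-dimensional subspaces -/

theorem exists_norm_eq_one_of_not_isUpperSemiFredholm [CompleteSpace X] {T : X →L[𝕜] Y}
    (hT : ¬ IsUpperSemiFredholm T) (P : X →L[𝕜] X) [FiniteDimensional 𝕜 P.range]
    {ε : ℝ} (hε : 0 < ε) : ∃ x, P x = 0 ∧ ‖x‖ = 1 ∧ ‖T x‖ < ε := by
  by_contra! h
  refine hT (IsUpperSemiFredholm.of_bound P (c := ε⁻¹) fun x hx => ?_)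
  rcases eq_or_ne x 0 with rfl | hx0
  · simp
  have hn : 0 < ‖x‖ := norm_pos_iff.2 hx0
  have := h ((‖x‖⁻¹ : 𝕜) • x) (by simp [hx]) (norm_smul_inv_norm hx0)
  rw [map_smul, norm_smul, norm_inv, RCLike.norm_ofReal, abs_norm, inv_mul_eq_div,
    le_div_iff₀ hn] at this
  rw [inv_mul_eq_div, le_div_iff₀ hε]
  linarith

/-- One step in the construction of a sequence of finite-rank projections `P` along which
`T ∘ P` converges in norm. -/
theorem exists_projection_extension [CompleteSpace X] {T : X →L[𝕜] Y}
    (hT : ¬ IsUpperSemiFredholm T) {P : X →L[𝕜] X} (hPP : ∀ x, P (P x) = P x)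
    (hP : FiniteDimensional 𝕜 P.range) {ε : ℝ} (hε : 0 < ε) :
    ∃ Q : X →L[𝕜] X, (∀ x, Q (Q x) = Q x) ∧ FiniteDimensional 𝕜 Q.range ∧
      (∀ x, Q (P x) = P x) ∧ ‖T ∘L Q - T ∘L P‖ ≤ ε ∧ ∃ x, x ≠ 0 ∧ P x = 0 ∧ Q x = x := by
  set R : X →L[𝕜] X := ContinuousLinearMap.id 𝕜 X - P with hR
  have hRpos : 0 < ‖R‖ + 1 := by positivity
  obtain ⟨x, hPx, hx, hTx⟩ :=
    exists_norm_eq_one_of_not_isUpperSemiFredholm hT P (div_pos hε hRpos)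
  have hx0 : x ≠ 0 := by
    rintro rfl
    simp at hx
  obtain ⟨f, hf, hfx⟩ := exists_dual_vector 𝕜 x (by rw [hx]; exact one_ne_zero)
  rw [hx, RCLike.ofReal_one] at hfx
  have hRP : ∀ z, R (P z) = 0 := fun z => by simp [hR, hPP]
  have hRx : R x = x := by simp [hR, hPx]
  -- `R` kills the range of `P` and fixes `x`, and `f x = 1`, so `Q` projects onto the range of `P`
  -- plus the line through `x`.
  let Q : X →L[𝕜] X := P + (f ∘L R).smulRight x
  have hQ : ∀ z, Q z = P z + f (R z) • x := fun z => rfl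
  have hQP : ∀ z, Q (P z) = P z := fun z => by simp [hQ, hRP, hPP]
  have hQx : Q x = x := by simp [hQ, hPx, hRx, hfx]
  refine ⟨Q, fun z => ?_, ?_, hQP, ?_, x, hx0, hPx, hQx⟩
  · rw [hQ z, map_add, hQP, map_smul, hQx]
  · refine Submodule.finiteDimensional_of_le (S₂ := P.range ⊔ Submodule.span 𝕜 {x}) ?_
    rintro _ ⟨z, rfl⟩
    exact Submodule.add_mem_sup ⟨z, rfl⟩
      (Submodule.smul_mem _ _ (Submodule.mem_span_singleton_self x))
  · have hdiff : T ∘L Q - T ∘L P = (f ∘L R).smulRight (T x) := by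
      ext z
      simp [hQ]
    rw [hdiff, ContinuousLinearMap.norm_smulRight_apply]
    have h1 : ‖f ∘L R‖ ≤ ‖R‖ := by
      simpa [hf] using f.opNorm_comp_le R
    calc ‖f ∘L R‖ * ‖T x‖ ≤ (‖R‖ + 1) * (ε / (‖R‖ + 1)) := by gcongr; linarith
      _ = ε := by field_simp

/-- An operator that is not upper semi-Fredholm agrees with a compact operator on an
infinite-dimensional subspace. -/
theorem exists_isCompactOperator_of_not_isUpperSemiFredholm [CompleteSpace X] [CompleteSpace Y]
    {T : X →L[𝕜] Y} (hT : ¬ IsUpperSemiFredholm T) :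
    ∃ C : X →L[𝕜] Y, IsCompactOperator C ∧ ¬ FiniteDimensional 𝕜 (T - C).ker := by
  let S := {P : X →L[𝕜] X // (∀ x, P (P x) = P x) ∧ FiniteDimensional 𝕜 P.range}
  have step : ∀ (n : ℕ) (P : S), ∃ Q : S, (∀ x, Q.1 (P.1 x) = P.1 x) ∧
      ‖T ∘L Q.1 - T ∘L P.1‖ ≤ 1 / 2 / 2 ^ n ∧ ∃ x, x ≠ 0 ∧ P.1 x = 0 ∧ Q.1 x = x := by
    intro n P
    obtain ⟨Q, h1, h2, h3⟩ := exists_projection_extension hT P.2.1 P.2.2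
      (ε := 1 / 2 / 2 ^ n) (by positivity)
    exact ⟨⟨Q, h1, h2⟩, h3⟩
  choose next hcomp hnorm y hy0 hPy hQy using step
  have hzero : FiniteDimensional 𝕜 (0 : X →L[𝕜] X).range :=
    Submodule.finiteDimensional_of_le (S₂ := ⊥) (by rintro _ ⟨x, rfl⟩; simp)
  let P : ℕ → S := fun n => Nat.rec ⟨0, fun x => rfl, hzero⟩ next n
  have hPsucc : ∀ n, P (n + 1) = next n (P n) := fun n => rfl
  have hcauchy : CauchySeq fun n => T ∘L (P n).1 := by
    refine cauchySeq_of_le_geometric_two (C := 1) fun n => ?_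
    rw [dist_comm, dist_eq_norm, hPsucc]
    exact hnorm n (P n)
  obtain ⟨C, hC⟩ := cauchySeq_tendsto_of_complete hcauchy
  have hmono : ∀ m n, m ≤ n → ∀ z, (P m).1 z = z → (P n).1 z = z := by
    intro m n hmn z hz
    induction n, hmn using Nat.le_induction with
    | base => exact hz
    | succ n _ ih =>
      have := hcomp n (P n) z
      rwa [ih] at this
  have hCz : ∀ m z, (P m).1 z = z → (T - C) z = 0 := by
    intro m z hz
    have h1 : Tendsto (fun n => (T ∘L (P n).1) z) atTop (𝓝 (C z)) :=
      ((ContinuousLinearMap.apply 𝕜 Y z).continuous.tendsto C).comp hC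
    have h2 : Tendsto (fun n => (T ∘L (P n).1) z) atTop (𝓝 (T z)) := by
      refine tendsto_const_nhds.congr' ?_
      filter_upwards [eventually_ge_atTop m] with n hn
      simp [hmono m n hn z hz]
    simp [tendsto_nhds_unique h2 h1]
  refine ⟨C, isCompactOperator_of_tendsto hC (Eventually.of_forall fun n => ?_), fun hfin => ?_⟩
  · have := (P n).2.2
    have hloc : LocallyCompactSpace (P n).1.range :=
      .of_finiteDimensional_of_complete 𝕜 _
    exact (isCompactOperator_of_locallyCompactSpace_dom
      ((P n).1.codRestrict (P n).1.range fun x => ⟨x, rfl⟩)).clm_comp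
        (T ∘L (P n).1.range.subtypeL)
  -- The fixed spaces of the projections lie in the kernel of `T - C` and increase strictly, since
  -- `y n (P n)` is fixed by `P (n + 1)` and killed by `P n`.
  · let F : ℕ →o Submodule 𝕜 (T - C).ker :=
      { toFun := fun n =>
          ((P n).1 - ContinuousLinearMap.id 𝕜 X).ker.comap (T - C).ker.subtype
        monotone' := by
          intro m n hmn z hz
          have hz' : (P m).1 z - z = 0 := hz
          change (P n).1 z - z = 0
          rw [sub_eq_zero] at hz' ⊢
          exact hmono m n hmn z hz' }
    obtain ⟨n, hn⟩ := (monotone_stabilizes_iff_noetherian (R := 𝕜)).2 inferInstance F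
    have hy : (P (n + 1)).1 (y n (P n)) = y n (P n) := hQy n (P n)
    have hmem : (⟨y n (P n), hCz (n + 1) _ hy⟩ : (T - C).ker) ∈ F (n + 1) := by
      change (P (n + 1)).1 (y n (P n)) - y n (P n) = 0
      rw [hy, sub_self]
    rw [← hn (n + 1) n.le_succ] at hmem
    have h0 : (P n).1 (y n (P n)) - y n (P n) = 0 := hmem
    rw [hPy, zero_sub, neg_eq_zero] at h0
    exact hy0 _ _ h0

/-- Every closed infinite-dimensional subspace contains a closed infinite-dimensional subspace on
which a given operator is either compact or bounded below. -/
theorem exists_le_isCompactOperator_or_bound [CompleteSpace X] [CompleteSpace Y] (T : X →L[𝕜] Y)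
    {M : Submodule 𝕜 X} (hM : IsClosed (M : Set X)) (hinf : ¬ FiniteDimensional 𝕜 M) :
    ∃ N ≤ M, IsClosed (N : Set X) ∧ ¬ FiniteDimensional 𝕜 N ∧
      (IsCompactOperator (T ∘L N.subtypeL) ∨ ∃ c : ℝ, ∀ x ∈ N, ‖x‖ ≤ c * ‖T x‖) := by
  have : CompleteSpace M := hM.completeSpace_coe
  have hmap : ∀ L : Submodule 𝕜 M, IsClosed (L : Set M) → ¬ FiniteDimensional 𝕜 L →
      L.map M.subtype ≤ M ∧ IsClosed (L.map M.subtype : Set X) ∧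
        ¬ FiniteDimensional 𝕜 (L.map M.subtype) := by
    intro L hL hLinf
    refine ⟨Submodule.map_subtype_le _ _, ?_, fun h => hLinf ?_⟩
    · rw [Submodule.map_coe]
      exact hM.isClosedEmbedding_subtypeVal.isClosedMap _ hL
    · exact LinearEquiv.finiteDimensional
        (Submodule.equivMapOfInjective M.subtype M.injective_subtype L).symm
  by_cases hT : IsUpperSemiFredholm (T ∘L M.subtypeL)
  · obtain ⟨P, hP, c, hc⟩ := hT.exists_bound
    have hker : ¬ FiniteDimensional 𝕜 P.ker := by
      have := not_finiteDimensional_inf_ker (M := (⊤ : Submodule 𝕜 M))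
        (fun h => hinf (LinearEquiv.finiteDimensional Submodule.topEquiv)) P
      rwa [top_inf_eq] at this
    obtain ⟨h1, h2, h3⟩ := hmap _ P.isClosed_ker hker
    refine ⟨_, h1, h2, h3, .inr ⟨c, ?_⟩⟩
    rintro _ ⟨x, hx, rfl⟩
    exact hc x hx
  · obtain ⟨C, hC, hker⟩ := exists_isCompactOperator_of_not_isUpperSemiFredholm hT
    obtain ⟨h1, h2, h3⟩ := hmap _ (T ∘L M.subtypeL - C).isClosed_ker hker
    refine ⟨_, h1, h2, h3, .inl ?_⟩
    rw [isCompactOperator_comp_subtypeL_iff]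
    obtain ⟨K, hK, hs⟩ := hC.image_closedBall_subset_compact (f := (C : M →ₗ[𝕜] Y)) 1
    refine ⟨K, hK, ?_⟩
    rintro _ ⟨x, hx, rfl⟩ hx1
    have h : T x - C x = 0 := hx
    have : T x = C x := sub_eq_zero.1 h
    change T x ∈ K
    rw [this]
    exact hs ⟨x, by simpa using hx1, rfl⟩

/-! ### Strictly singular perturbations -/

theorem IsStrictlySingular.exists_le_isCompactOperator [CompleteSpace X] [CompleteSpace Y]
    {T : X →L[𝕜] Y} (hT : IsStrictlySingular T) {M : Submodule 𝕜 X}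
    (hM : IsClosed (M : Set X)) (hinf : ¬ FiniteDimensional 𝕜 M) :
    ∃ N ≤ M, IsClosed (N : Set X) ∧ ¬ FiniteDimensional 𝕜 N ∧
      IsCompactOperator (T ∘L N.subtypeL) := by
  obtain ⟨N, hN, hNc, hNinf, h | ⟨c, hc⟩⟩ := exists_le_isCompactOperator_or_bound T hM hinf
  · exact ⟨N, hN, hNc, hNinf, h⟩
  · exact absurd (isClosedEmbedding_comp_subtypeL hNc hc).isEmbedding (hT N hNc hNinf)

theorem IsCompactOperator.isStrictlySingular [CompleteSpace X] {T : X →L[𝕜] Y}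
    (hT : IsCompactOperator T) : IsStrictlySingular T := by
  intro M hM hinf hemb
  obtain ⟨c, -, hc⟩ := exists_bound_of_isEmbedding hemb
  exact hinf (finiteDimensional_of_isCompactOperator_of_bound hM (hT.comp_clm M.subtypeL) hc)

/-- Strictly singular perturbations preserve upper semi-Fredholm operators. -/
theorem IsUpperSemiFredholm.add_isStrictlySingular [CompleteSpace X] [CompleteSpace Y]
    {T K : X →L[𝕜] Y} (hT : IsUpperSemiFredholm T) (hK : IsStrictlySingular K) :
    IsUpperSemiFredholm (T + K) := by
  by_contra h
  obtain ⟨C, hC, hinf⟩ := exists_isCompactOperator_of_not_isUpperSemiFredholm h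
  obtain ⟨N, hN, hNc, hNinf, hKN⟩ :=
    hK.exists_le_isCompactOperator (T + K - C).isClosed_ker hinf
  refine hT.not_isCompactOperator_comp_subtypeL hNc hNinf ?_
  have heq : ⇑(T ∘L N.subtypeL) = ⇑C ∘ ⇑N.subtypeL - ⇑(K ∘L N.subtypeL) := by
    funext x
    have hx : T x + K x - C x = 0 := hN x.2
    exact eq_sub_of_add_eq (sub_eq_zero.1 hx)
  rw [heq]
  exact (hC.comp_clm N.subtypeL).sub hKN

theorem strictlySingular_subset_perturbationClass [CompleteSpace X] [CompleteSpace Y] :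
    strictlySingular 𝕜 X Y ⊆ perturbationClass (upperSemiFredholm 𝕜 X Y) :=
  fun _ hK _ hT => IsUpperSemiFredholm.add_isStrictlySingular hT hK

/-! ### Composition with operators on the domain -/

theorem IsUpperSemiFredholm.comp_equiv {T : X →L[𝕜] Y} (hT : IsUpperSemiFredholm T)
    (e : X ≃L[𝕜] X) : IsUpperSemiFredholm (T ∘L (e : X →L[𝕜] X)) := by
  obtain ⟨hker, hran⟩ := hT
  constructor
  · let f : (T ∘L (e : X →L[𝕜] X)).ker →ₗ[𝕜] T.ker :=
      (e.toLinearEquiv.toLinearMap).restrict fun x hx => hx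
    exact FiniteDimensional.of_injective f fun x y hxy =>
      Subtype.ext (e.injective (congrArg Subtype.val hxy))
  · convert hran using 1
    ext y
    constructor
    · rintro ⟨x, rfl⟩
      exact ⟨e x, rfl⟩
    · rintro ⟨x, rfl⟩
      exact ⟨e.symm x, by simp⟩

theorem add_mem_perturbationClass {A : Set (X →L[𝕜] Y)} {K L : X →L[𝕜] Y}
    (hK : K ∈ perturbationClass A) (hL : L ∈ perturbationClass A) :
    K + L ∈ perturbationClass A := by
  intro T hT
  rw [← add_assoc]
  exact hL _ (hK T hT)

/-- `T + K e = (T e⁻¹ + K) e`, and Φ₊ is stable under composition with isomorphisms. -/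
theorem comp_equiv_mem_perturbationClass {K : X →L[𝕜] Y}
    (hK : K ∈ perturbationClass (upperSemiFredholm 𝕜 X Y)) (e : X ≃L[𝕜] X) :
    K ∘L (e : X →L[𝕜] X) ∈ perturbationClass (upperSemiFredholm 𝕜 X Y) := by
  intro T hT
  have h := IsUpperSemiFredholm.comp_equiv (hK _ (IsUpperSemiFredholm.comp_equiv hT e.symm)) e
  have heq : T + K ∘L (e : X →L[𝕜] X) =
      (T ∘L (e.symm : X →L[𝕜] X) + K) ∘L (e : X →L[𝕜] X) := by
    ext x
    simp
  rw [heq]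
  exact h

/-- The perturbation class of the upper semi-Fredholm operators is stable under composition with
operators on the domain. -/
theorem comp_mem_perturbationClass [CompleteSpace X] {K : X →L[𝕜] Y}
    (hK : K ∈ perturbationClass (upperSemiFredholm 𝕜 X Y)) (A : X →L[𝕜] X) :
    K ∘L A ∈ perturbationClass (upperSemiFredholm 𝕜 X Y) := by
  -- `A = r - r (1 - r⁻¹ A)`, where `1 - r⁻¹ A` is invertible by the Neumann series.
  set r : ℝ := ‖A‖ + 1 with hr
  have hr0 : 0 < r := by positivity
  have hr𝕜 : (r : 𝕜) ≠ 0 := by exact_mod_cast hr0.ne'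
  have hlt : ‖(r : 𝕜)⁻¹ • A‖ < 1 := by
    rw [norm_smul, norm_inv, RCLike.norm_ofReal, abs_of_pos hr0, inv_mul_eq_div,
      div_lt_one hr0]
    linarith
  let u : X ≃L[𝕜] X := ContinuousLinearEquiv.unitsEquiv 𝕜 X (Units.oneSub _ hlt)
  let a : X ≃L[𝕜] X := ContinuousLinearEquiv.smulLeft (Units.mk0 (r : 𝕜) hr𝕜)
  let b : X ≃L[𝕜] X := ContinuousLinearEquiv.smulLeft (Units.mk0 (-(r : 𝕜)) (neg_ne_zero.2 hr𝕜))
  have hadd := add_mem_perturbationClass (comp_equiv_mem_perturbationClass hK a)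
    (comp_equiv_mem_perturbationClass (comp_equiv_mem_perturbationClass hK u) b)
  convert hadd using 1
  ext x
  have hu : u x = x - (r : 𝕜)⁻¹ • A x := rfl
  have ha : a x = (r : 𝕜) • x := rfl
  have hb : ∀ z, b z = (-(r : 𝕜)) • z := fun z => rfl
  simp [hu, ha, hb, smul_smul, hr𝕜, smul_sub]

theorem neg_mem_perturbationClass [CompleteSpace X] {K : X →L[𝕜] Y}
    (hK : K ∈ perturbationClass (upperSemiFredholm 𝕜 X Y)) :
    -K ∈ perturbationClass (upperSemiFredholm 𝕜 X Y) := by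
  convert comp_mem_perturbationClass hK (-ContinuousLinearMap.id 𝕜 X) using 1
  ext x
  simp

/-- On a subprojective space, the perturbation class of the upper semi-Fredholm operators consists
of strictly singular operators. -/
theorem perturbationClass_subset_strictlySingular [CompleteSpace X] [CompleteSpace Y]
    (hne : (upperSemiFredholm 𝕜 X Y).Nonempty) (hX : IsSubprojective 𝕜 X) :
    perturbationClass (upperSemiFredholm 𝕜 X Y) ⊆ strictlySingular 𝕜 X Y := by
  intro K hK M hM hinf hemb
  obtain ⟨S, hS⟩ := hne
  obtain ⟨c, hc0, hc⟩ := exists_bound_of_isEmbedding hemb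
  obtain ⟨N, hNM, hNinf, p, hp⟩ := hX M hM hinf
  let P : X →L[𝕜] X := N.subtypeL ∘L p
  have hPN : ∀ x ∈ N, P x = x := fun x hx => congrArg Subtype.val (hp ⟨x, hx⟩)
  let V : X →L[𝕜] X := P - ContinuousLinearMap.id 𝕜 X
  let T : X →L[𝕜] Y := K ∘L P - S ∘L V
  have hKP := comp_mem_perturbationClass hK P
  -- Otherwise `T - K P = -S V` would be in Φ₊, but `V` vanishes on `N`.
  have hT : ¬ IsUpperSemiFredholm T := by
    intro h
    have h' := (neg_mem_perturbationClass hKP T h).1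
    refine hNinf (Submodule.finiteDimensional_of_le (S₂ := (T + -(K ∘L P)).ker) fun x hx => ?_)
    have hV : V x = 0 := sub_eq_zero.2 (hPN x hx)
    change K (P x) - S (V x) + -K (P x) = 0
    rw [hV, map_zero, sub_zero, add_neg_cancel]
  obtain ⟨C, hC, hker⟩ := exists_isCompactOperator_of_not_isUpperSemiFredholm hT
  have hTC : ∀ x ∈ (T - C).ker, K (P x) - S (V x) = C x := fun x hx => sub_eq_zero.1 hx
  obtain ⟨E, hE, hEc, hEinf, hV | ⟨d, hd⟩⟩ :=
    exists_le_isCompactOperator_or_bound V (T - C).isClosed_ker hker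
  -- `V` is compact on `E`. Then `P` cannot be compact on `F`, as `1 = P - V`. If `P` is bounded
  -- below there, so is `K P`, which equals the compact `C + S V`.
  · obtain ⟨F, hF, hFc, hFinf, hP | ⟨d, hd⟩⟩ :=
      exists_le_isCompactOperator_or_bound P hEc hEinf
    · refine hFinf (finiteDimensional_of_isCompactOperator_of_bound
        (T := ContinuousLinearMap.id 𝕜 X) (c := 1) hFc ?_ (by simp))
      have heq : ⇑(ContinuousLinearMap.id 𝕜 X ∘L F.subtypeL) =
          ⇑(P ∘L F.subtypeL) - ⇑(V ∘L F.subtypeL) := by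
        funext x
        change (x : X) = P x - (P x - x)
        abel
      rw [heq]
      exact hP.sub (hV.comp_subtypeL_mono hF)
    · refine hFinf (finiteDimensional_of_isCompactOperator_of_bound
        (T := K ∘L P) (c := |d| * c) hFc ?_ fun x hx => ?_)
      · have heq : ⇑((K ∘L P) ∘L F.subtypeL) =
            ⇑C ∘ ⇑F.subtypeL + ⇑S ∘ ⇑(V ∘L F.subtypeL) := by
          funext x
          exact sub_eq_iff_eq_add.1 (hTC x (hE (hF x.2)))
        rw [heq]
        exact (hC.comp_clm F.subtypeL).add ((hV.comp_subtypeL_mono hF).clm_comp S)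
      · calc ‖x‖ ≤ d * ‖P x‖ := hd x hx
          _ ≤ |d| * (c * ‖K (P x)‖) := by
            gcongr
            · exact le_abs_self d
            · exact hc _ (hNM (p x).2)
          _ = |d| * c * ‖(K ∘L P) x‖ := (mul_assoc _ _ _).symm
  · have : CompleteSpace E := hEc.completeSpace_coe
    have hcl := isClosedEmbedding_comp_subtypeL hEc hd
    have hrinf : ¬ FiniteDimensional 𝕜 (V ∘L E.subtypeL).range := fun h =>
      hEinf (LinearEquiv.finiteDimensional (LinearEquiv.ofInjective
        (V ∘L E.subtypeL).toLinearMap hcl.injective).symm)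
    obtain ⟨G, hG, hGinf, q, hq⟩ := hX (V ∘L E.subtypeL).range hcl.isClosed_range hrinf
    let e := (V ∘L E.subtypeL).equivRange hcl.injective hcl.isClosed_range
    -- `A` is `q` followed by the inverse of `V` on `E`. Hence `V A = q`, and on the range of `A`
    -- the relation `K P - S V = C` expresses `S q` through members of PΦ₊.
    let A : X →L[𝕜] X := E.subtypeL ∘L (e.symm : _ →L[𝕜] E) ∘L
      (G.subtypeL ∘L q).codRestrict (V ∘L E.subtypeL).range fun x => hG (q x).2
    have hAE : ∀ x, A x ∈ E := fun x => Subtype.property _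
    have hVA : ∀ x, V (A x) = q x := fun x => congrArg Subtype.val (e.apply_symm_apply _)
    have hSq : S ∘L (G.subtypeL ∘L q) = (K ∘L P) ∘L A + -(C ∘L A) := by
      ext x
      have := hTC (A x) (hE (hAE x))
      rw [hVA] at this
      change S (q x) = K (P (A x)) + -C (A x)
      rw [← this]
      abel
    have hCA : C ∘L A ∈ perturbationClass (upperSemiFredholm 𝕜 X Y) :=
      strictlySingular_subset_perturbationClass
        (IsCompactOperator.isStrictlySingular (hC.comp_clm A))
    have hmem := neg_mem_perturbationClass (add_mem_perturbationClass
      (comp_mem_perturbationClass hKP A) (neg_mem_perturbationClass hCA))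
    rw [← hSq] at hmem
    -- `S - S q` is in Φ₊ and yet vanishes on `G`.
    have hfin := (hmem S hS).1
    refine hGinf (Submodule.finiteDimensional_of_le
      (S₂ := (S + -(S ∘L (G.subtypeL ∘L q))).ker) fun x hx => ?_)
    have hqx : (q x : X) = x := congrArg Subtype.val (hq ⟨x, hx⟩)
    change S x + -S (q x) = 0
    rw [hqx, add_neg_cancel]

end

theorem theorem2 {𝕜 : Type*} [RCLike 𝕜]
    {X : Type*} [NormedAddCommGroup X] [NormedSpace 𝕜 X] [CompleteSpace X]
    {Y : Type*} [NormedAddCommGroup Y] [NormedSpace 𝕜 Y] [CompleteSpace Y]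
    (hne : (upperSemiFredholm 𝕜 X Y).Nonempty) (hX : IsSubprojective 𝕜 X) :
    perturbationClass (upperSemiFredholm 𝕜 X Y) = strictlySingular 𝕜 X Y := by
  exact (perturbationClass_subset_strictlySingular hne hX).antisymm
    strictlySingular_subset_perturbationClass
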